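/- Two-party policy competition game. Let $k\ge 1$ and $S=\{\mathbf z\in[-1,1]^k:\|\mathbf z\|\le 1\}$ (Euclidean norm). Let $V=V_A\,\dot\cup\,V_B$ be a finite set of voters, split into the disjoint sets of supporters of party $A$ and of party $B$, and let each voter $v$ have a preference vector $\mathbf q_v\in S$. Put $Q_A=\sum_{v\in V_A}\mathbf q_v$, $Q_B=\sum_{v\in V_B}\mathbf q_v$, $Q=\sum_{v\in V}\mathbf q_v=Q_A+Q_B$, and assume the normalization $\|Q_A\|\le 1$, $\|Q_B\|\le 1$. The parties choose policies $\mathbf z_A,\mathbf z_B\in S$. Party $A$ wins with probability $p_A=\frac12+\frac18(\mathbf z_A-\mathbf z_B)^{\top}Q$ and party $B$ with probability $p_B=1-p_A$. The payoff of party $X\in\{A,B\}$ is the expected utility of its own supporters, $$R_X(\mathbf z_A,\mathbf z_B)=p_A\,\mathbf z_A^{\top}Q_X+p_B\,\mathbf z_B^{\top}Q_X .$$ Theorem. Every such game, whether or not it is consensus-reachable (that is, $Q_A^{\top}Q\ge 0$ and $Q_B^{\top}Q\ge 0$), has a pure-strategy Nash equilibrium: there are $\mathbf z_A^*,\mathbf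 z_B^*\in S$ such that $R_A(\mathbf z,\mathbf z_B^*)\le R_A(\mathbf z_A^*,\mathbf z_B^*)$ and $R_B(\mathbf z_A^*,\mathbf z)\le R_B(\mathbf z_A^*,\mathbf z_B^*)$ for all $\mathbf z\in S$. Moreover the equilibrium can be chosen to satisfy the egoistic property: $\mathbf z_A^{*\top}Q_A\ge \mathbf z_B^{*\top}Q_A$ and $\mathbf z_B^{*\top}Q_B\ge \mathbf z_A^{*\top}Q_B$. -/

import Mathlib

/-- The policy domain `S = {z ∈ [-1, 1]^k : ‖z‖ ≤ 1}`, with the Euclidean norm. -/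
def policyDomain (k : ℕ) : Set (EuclideanSpace ℝ (Fin k)) :=
  {z | (∀ i, z i ∈ Set.Icc (-1 : ℝ) 1) ∧ ‖z‖ ≤ 1}

/-- The data of a two-party policy competition game in `ℝ^k` with voter set `V`:
the disjoint sets of supporters of the two parties, which together make up `V`, and the voters'
preference vectors in `S`, normalized so that the aggregate preference vector of each party
has norm at most one. -/
structure PolicyGame (k : ℕ) (V : Type*) [Fintype V] where
  /-- supporters of party A -/
  VA : Finset V
  /-- supporters of party B -/
  VB : Finset V
  disjoint : Disjoint VA VB
  cover : ∀ v, v ∈ VA ∨ v ∈ VB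
  /-- preference vectors -/
  q : V → EuclideanSpace ℝ (Fin k)
  q_mem : ∀ v, q v ∈ policyDomain k
  norm_A_le : ‖∑ v ∈ VA, q v‖ ≤ 1
  norm_B_le : ‖∑ v ∈ VB, q v‖ ≤ 1

namespace PolicyGame

variable {k : ℕ} {V : Type*} [Fintype V]

/-- The aggregate preference vector `Q` of all voters. -/
noncomputable def Q (G : PolicyGame k V) : EuclideanSpace ℝ (Fin k) := ∑ v, G.q v

/-- The utility that policy `z` brings to the supporters of party A. -/
noncomputable def utilityA (G : PolicyGame k V) (z : EuclideanSpace ℝ (Fin k)) : ℝ :=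
  ∑ v ∈ G.VA, inner ℝ z (G.q v)

/-- The utility that policy `z` brings to the supporters of party B. -/
noncomputable def utilityB (G : PolicyGame k V) (z : EuclideanSpace ℝ (Fin k)) : ℝ :=
  ∑ v ∈ G.VB, inner ℝ z (G.q v)

/-- The probability `p_A = 1/2 + (z_A - z_B)ᵀ Q / 8` that party A wins. -/
noncomputable def winProbA (G : PolicyGame k V) (zA zB : EuclideanSpace ℝ (Fin k)) : ℝ :=
  1 / 2 + 1 / 8 * inner ℝ (zA - zB) G.Q

/-- The probability `p_B = 1 - p_A` that party B wins. -/
noncomputable def winProbB (G : PolicyGame k V) (zA zB : EuclideanSpace ℝ (Fin k)) : ℝ :=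
  1 - G.winProbA zA zB

/-- Payoff of party A: the expected utility of its supporters under the winner's policy. -/
noncomputable def payoffA (G : PolicyGame k V) (zA zB : EuclideanSpace ℝ (Fin k)) : ℝ :=
  G.winProbA zA zB * G.utilityA zA + G.winProbB zA zB * G.utilityA zB

/-- Payoff of party B: the expected utility of its supporters under the winner's policy. -/
noncomputable def payoffB (G : PolicyGame k V) (zA zB : EuclideanSpace ℝ (Fin k)) : ℝ :=
  G.winProbA zA zB * G.utilityB zA + G.winProbB zA zB * G.utilityB zB

/-- The egoistic property: each party's policy gives its own supporters at least the utility
that the opponent's policy gives them. -/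
def Egoistic (G : PolicyGame k V) (zA zB : EuclideanSpace ℝ (Fin k)) : Prop :=
  G.utilityA zB ≤ G.utilityA zA ∧ G.utilityB zA ≤ G.utilityB zB

/-- The profile `(zA, zB)` of policies in `S` is a pure-strategy Nash equilibrium: no party can
increase its payoff by moving alone to any other policy in `S`. -/
def IsPSNE (G : PolicyGame k V) (zA zB : EuclideanSpace ℝ (Fin k)) : Prop :=
  zA ∈ policyDomain k ∧ zB ∈ policyDomain k ∧
    (∀ z ∈ policyDomain k, G.payoffA z zB ≤ G.payoffA zA zB) ∧
    (∀ z ∈ policyDomain k, G.payoffB zA z ≤ G.payoffB zA zB)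

end PolicyGame

/-!
Write `P` and `R` for the aggregate preferences of the two parties. Up to a positive factor and a
term that does not depend on the own policy, the payoff of the party with preference `P` is
`(4 + ⟪x - y, P + R⟫) * ⟪x - y, P⟫`, a product of two affine functions of its policy `x`, the
first of which is nonnegative on the unit ball. Such a product is quasiconcave where the second
factor is nonnegative too, so first-order conditions are sufficient
(`IsStationaryProfile.gain_le`), and it suffices to find an egoistic profile satisfying them.

The gradient is a combination of `P` and `R`, and in an egoistic profile its coefficients are
nonnegative. Hence both policies can be sought on curves: `x` the normalization of `P + s • R`
and `y` that of `R + t • P`, with `s, t ∈ [0, 1]`. Such profiles are automatically egoistic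
(`normalize_advantage_nonneg`), and the first-order conditions become two scalar equations in
`(s, t)`. No fixed point theorem in dimension two is needed: strict quasiconcavity
(`gain_lt_of_normalize`) shows that the first equation has one root `s` for each `t`, this root is
continuous in `t`, and the intermediate value theorem solves the second equation
(`exists_common_zero_of_unique_zero`). The curves are undefined only if `P` and `R` point in
opposite directions or one of them vanishes, and then both parties playing their favourite policy
is an equilibrium (`exists_isStationaryProfile_of_eq_neg_smul`).
-/

open scoped InnerProductSpace

/-! ### Two equations on the unit square -/

/-- Two equations on the unit square, the first of which has exactly one root `s` for each `t`:
that root depends continuously on `t`, so the intermediate value theorem in `t` produces a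
common root. -/
theorem exists_common_zero_of_unique_zero {F G : unitInterval × unitInterval → ℝ}
    (hF : Continuous F) (hG : Continuous G)
    (hF0 : ∀ t, F (0, t) ≤ 0) (hF1 : ∀ t, 0 ≤ F (1, t))
    (huniq : ∀ s s' t, F (s, t) = 0 → F (s', t) = 0 → s = s')
    (hG0 : ∀ s, G (s, 0) ≤ 0) (hG1 : ∀ s, 0 ≤ G (s, 1)) :
    ∃ x, F x = 0 ∧ G x = 0 := by
  have hex : ∀ t, ∃ s, F (s, t) = 0 := fun t =>
    mem_range_of_exists_le_of_exists_ge (f := fun s => F (s, t)) (by fun_prop)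
      ⟨0, hF0 t⟩ ⟨1, hF1 t⟩
  choose σ hσ using hex
  have hcont : Continuous σ := by
    refine continuous_iff_isClosed.2 fun C hC => ?_
    -- The preimage of `C` is the projection of a closed subset of the compact square.
    have himage : σ ⁻¹' C = Prod.snd '' ({x | F x = 0} ∩ Prod.fst ⁻¹' C) := by
      ext t
      constructor
      · intro ht
        exact ⟨(σ t, t), ⟨hσ t, ht⟩, rfl⟩
      · rintro ⟨⟨s, t'⟩, ⟨hs, hsC⟩, rfl⟩
        have h := huniq _ _ _ (hσ t') hs
        simpa [h] using hsC
    rw [himage]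
    exact isClosedMap_snd_of_compactSpace _
      ((isClosed_eq hF continuous_const).inter (hC.preimage continuous_fst))
  obtain ⟨t, ht⟩ := mem_range_of_exists_le_of_exists_ge (f := fun t => G (σ t, t)) (c := 0)
    (by fun_prop) ⟨0, hG0 _⟩ ⟨1, hG1 _⟩
  exact ⟨(σ t, t), hσ t, ht⟩

/-! ### Products of two affine functions -/

/-- First-order optimality implies optimality for the product `p * u`: a direction `(β, α)` that
does not increase it to first order does not increase it at all, as long as the first factor stays
nonnegative. -/
theorem mul_add_le_of_linear_nonpos {p u α β : ℝ} (hp : 0 < p) (hu : 0 ≤ u) (hpβ : 0 ≤ p + β)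
    (h : p * α + u * β ≤ 0) : (p + β) * (u + α) ≤ p * u := by
  rcases le_or_gt 0 (u + α) with hα | hα
  · rcases le_or_gt β 0 with hβ | hβ
    · rcases le_or_gt α 0 with hα' | hα'
      · nlinarith [mul_nonneg hα (neg_nonneg.2 hβ), mul_nonneg hp.le (neg_nonneg.2 hα')]
      · nlinarith [mul_nonneg hα'.le (neg_nonneg.2 hβ)]
    · rcases le_or_gt α 0 with hα' | hα'
      · nlinarith [mul_nonneg hβ.le (neg_nonneg.2 hα')]
      · nlinarith [mul_pos hp hα', mul_nonneg hu hβ.le]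
  · nlinarith [mul_nonneg hpβ (neg_nonneg.2 hα.le), mul_nonneg hp.le hu]

/-- Strict form of `mul_add_le_of_linear_nonpos`, where instead the second factor is required to
stay nonnegative. -/
theorem mul_add_lt_of_linear_neg {p u α β : ℝ} (hp : 0 < p) (hu : 0 ≤ u) (huα : 0 ≤ u + α)
    (h : p * α + u * β < 0) : (p + β) * (u + α) < p * u := by
  rcases le_or_gt β 0 with hβ | hβ
  · rcases lt_trichotomy α 0 with hα | rfl | hα
    · nlinarith [mul_nonneg huα (neg_nonneg.2 hβ), mul_pos hp (neg_pos.2 hα)]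
    · nlinarith
    · nlinarith [mul_nonneg hα.le (neg_nonneg.2 hβ)]
  · rcases le_or_gt α 0 with hα | hα
    · nlinarith [mul_nonneg hβ.le (neg_nonneg.2 hα)]
    · nlinarith [mul_pos hp hα, mul_nonneg hu hβ.le]

/-! ### Linear functionals on the unit ball -/

section

variable {E : Type*} [NormedAddCommGroup E] [InnerProductSpace ℝ E]

theorem inner_le_norm_of_norm_le_one {z g : E} (hz : ‖z‖ ≤ 1) : ⟪z, g⟫_ℝ ≤ ‖g‖ :=
  (real_inner_le_norm z g).trans (mul_le_of_le_one_left (norm_nonneg g) hz)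

theorem inner_sub_le_two {x y g : E} (hx : ‖x‖ ≤ 1) (hy : ‖y‖ ≤ 1) (hg : ‖g‖ ≤ 1) :
    ⟪x - y, g⟫_ℝ ≤ 2 := by
  have h1 := inner_le_norm_of_norm_le_one (g := g) hx
  have h2 := inner_le_norm_of_norm_le_one (z := -y) (g := g) (by rwa [norm_neg])
  rw [inner_neg_left] at h2
  rw [inner_sub_left]
  linarith

theorem norm_normalize_le_one (g : E) : ‖NormedSpace.normalize g‖ ≤ 1 := by
  rcases eq_or_ne g 0 with rfl | hg
  · simp
  · exact (NormedSpace.norm_normalize hg).le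

theorem inner_normalize_self (g : E) : ⟪NormedSpace.normalize g, g⟫_ℝ = ‖g‖ := by
  rcases eq_or_ne g 0 with rfl | hg
  · simp
  · have : ‖g‖ ≠ 0 := norm_ne_zero_iff.2 hg
    rw [NormedSpace.normalize, real_inner_smul_left, real_inner_self_eq_norm_sq]
    field_simp

theorem inner_le_inner_normalize {z : E} (hz : ‖z‖ ≤ 1) (g : E) :
    ⟪z, g⟫_ℝ ≤ ⟪NormedSpace.normalize g, g⟫_ℝ :=
  (inner_le_norm_of_norm_le_one hz).trans_eq (inner_normalize_self g).symm

/-- The normalization of `g ≠ 0` is the only maximizer of `⟪·, g⟫` on the unit ball. -/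
theorem inner_lt_inner_normalize {z g : E} (hz : ‖z‖ ≤ 1) (hg : g ≠ 0)
    (hne : z ≠ NormedSpace.normalize g) : ⟪z, g⟫_ℝ < ⟪NormedSpace.normalize g, g⟫_ℝ := by
  refine lt_of_le_of_ne (inner_le_inner_normalize hz g) fun h => hne ?_
  have hg' : 0 < ‖g‖ := norm_pos_iff.2 hg
  have h1 : ⟪z, NormedSpace.normalize g⟫_ℝ = 1 := by
    rw [NormedSpace.normalize, real_inner_smul_right, h, inner_normalize_self]
    field_simp
  have h2 := norm_sub_sq_real z (NormedSpace.normalize g)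
  rw [h1, NormedSpace.norm_normalize hg] at h2
  have h3 : ‖z - NormedSpace.normalize g‖ ^ 2 ≤ 0 := by nlinarith [norm_nonneg z]
  exact sub_eq_zero.1 (norm_eq_zero.1 (pow_eq_zero_iff two_ne_zero |>.1
    (le_antisymm h3 (sq_nonneg _))))

/-! ### The gain of a party and its first-order conditions -/

/-- Eight times the gain that a party with aggregate preference `P` draws from playing `x` against
`y`, over the payoff of conceding with `y`, when the opponent's aggregate preference is `R`:
`4 + ⟪x - y, P + R⟫` is eight times its winning probability. -/
noncomputable def gain (P R x y : E) : ℝ := (4 + ⟪x - y, P + R⟫_ℝ) * ⟪x - y, P⟫_ℝ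

/-- The gradient of `gain P R · y` at `x`, written in terms of the own advantage `⟪x - y, P⟫`
and the opponent's advantage `⟪y - x, R⟫`. -/
noncomputable def gainGradient (P R x y : E) : E :=
  (4 + 2 * ⟪x - y, P⟫_ℝ - ⟪y - x, R⟫_ℝ) • P + ⟪x - y, P⟫_ℝ • R

/-- First-order equilibrium conditions for parties with aggregate preferences `P` and `R` playing
`x` and `y` in the unit ball: the profile is egoistic, and each party's policy maximizes the
linearization of its own gain over the ball. -/
structure IsStationaryProfile (P R x y : E) : Prop where
  norm_left : ‖x‖ ≤ 1
  norm_right : ‖y‖ ≤ 1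
  egoistic_left : 0 ≤ ⟪x - y, P⟫_ℝ
  egoistic_right : 0 ≤ ⟪y - x, R⟫_ℝ
  stationary_left : ∀ z, ‖z‖ ≤ 1 → ⟪z - x, gainGradient P R x y⟫_ℝ ≤ 0
  stationary_right : ∀ z, ‖z‖ ≤ 1 → ⟪z - y, gainGradient R P y x⟫_ℝ ≤ 0

variable {P R x y z : E}

theorem IsStationaryProfile.symm (h : IsStationaryProfile P R x y) :
    IsStationaryProfile R P y x :=
  ⟨h.norm_right, h.norm_left, h.egoistic_right, h.egoistic_left, h.stationary_right,
    h.stationary_left⟩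

theorem winning_factor_eq (P R x y : E) :
    4 + ⟪x - y, P + R⟫_ℝ = 4 + ⟪x - y, P⟫_ℝ - ⟪y - x, R⟫_ℝ := by
  rw [← neg_sub y x, inner_neg_left, inner_neg_left, inner_add_right]
  ring

theorem gain_eq (P R x y z : E) :
    gain P R z y = (4 + ⟪x - y, P + R⟫_ℝ + ⟪z - x, P + R⟫_ℝ) *
      (⟪x - y, P⟫_ℝ + ⟪z - x, P⟫_ℝ) := by
  rw [gain, ← sub_add_sub_cancel z x y, inner_add_left, inner_add_left]
  ring

theorem inner_gainGradient (P R x y z : E) :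
    ⟪z - x, gainGradient P R x y⟫_ℝ =
      (4 + ⟪x - y, P + R⟫_ℝ) * ⟪z - x, P⟫_ℝ + ⟪x - y, P⟫_ℝ * ⟪z - x, P + R⟫_ℝ := by
  rw [winning_factor_eq, gainGradient, inner_add_right, inner_add_right, real_inner_smul_right,
    real_inner_smul_right]
  ring

theorem winning_factor_pos (hx : ‖x‖ ≤ 1) (hy : ‖y‖ ≤ 1) (hR : ‖R‖ ≤ 1)
    (hu : 0 ≤ ⟪x - y, P⟫_ℝ) : 0 < 4 + ⟪x - y, P + R⟫_ℝ := by
  rw [winning_factor_eq]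
  linarith [inner_sub_le_two hy hx hR]

/-- On the ball the gain is a product of two affine functions, of which the first is nonnegative.
Such a product is quasiconcave where both are nonnegative, and policies making the second one
negative are worse than conceding, so first-order conditions suffice. -/
theorem IsStationaryProfile.gain_le (h : IsStationaryProfile P R x y) (hP : ‖P‖ ≤ 1)
    (hR : ‖R‖ ≤ 1) (hz : ‖z‖ ≤ 1) : gain P R z y ≤ gain P R x y := by
  rw [gain_eq P R x y z, gain]
  refine mul_add_le_of_linear_nonpos
    (winning_factor_pos h.norm_left h.norm_right hR h.egoistic_left) h.egoistic_left ?_ ?_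
  · have h1 : ⟪z - x, P + R⟫_ℝ = ⟪z - y, P + R⟫_ℝ - ⟪x - y, P + R⟫_ℝ := by
      rw [← inner_sub_left, sub_sub_sub_cancel_right]
    have h2 := inner_sub_le_two h.norm_right hz hP
    have h3 := inner_sub_le_two h.norm_right hz hR
    rw [← neg_sub z y, inner_neg_left] at h2 h3
    rw [h1, inner_add_right (z - y)]
    linarith
  · rw [← inner_gainGradient]
    exact h.stationary_left z hz

/-- The gain gradient is a multiple of `P + s • R`, where `s` is the ratio of its coefficients at
`R` and at `P`. -/
theorem gainGradient_eq_smul {s : ℝ}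
    (hs : s * (4 + 2 * ⟪x - y, P⟫_ℝ - ⟪y - x, R⟫_ℝ) = ⟪x - y, P⟫_ℝ) :
    gainGradient P R x y = (4 + 2 * ⟪x - y, P⟫_ℝ - ⟪y - x, R⟫_ℝ) • (P + s • R) := by
  rw [gainGradient, smul_add, smul_smul, mul_comm _ s, hs]

theorem gradient_factor_pos (hx : ‖x‖ ≤ 1) (hy : ‖y‖ ≤ 1) (hR : ‖R‖ ≤ 1)
    (hu : 0 ≤ ⟪x - y, P⟫_ℝ) : 0 < 4 + 2 * ⟪x - y, P⟫_ℝ - ⟪y - x, R⟫_ℝ := by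
  linarith [inner_sub_le_two hy hx hR]

/-- The policy `x` in the direction `P + s • R` meets its first-order condition when `s` is the
ratio of the coefficients of its gain gradient. -/
theorem inner_sub_gainGradient_nonpos {s : ℝ} (hy : ‖y‖ ≤ 1) (hR : ‖R‖ ≤ 1)
    (hx : x = NormedSpace.normalize (P + s • R)) (hu : 0 ≤ ⟪x - y, P⟫_ℝ)
    (hs : s * (4 + 2 * ⟪x - y, P⟫_ℝ - ⟪y - x, R⟫_ℝ) = ⟪x - y, P⟫_ℝ) (hz : ‖z‖ ≤ 1) :
    ⟪z - x, gainGradient P R x y⟫_ℝ ≤ 0 := by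
  have hx1 : ‖x‖ ≤ 1 := hx ▸ norm_normalize_le_one _
  rw [gainGradient_eq_smul hs, real_inner_smul_right]
  refine mul_nonpos_of_nonneg_of_nonpos (gradient_factor_pos hx1 hy hR hu).le ?_
  rw [inner_sub_left, hx]
  exact sub_nonpos.2 (inner_le_inner_normalize hz _)

/-- The quasiconcavity is strict at a first-order point on the sphere: every other egoistic
policy is strictly worse. -/
theorem gain_lt_of_normalize {s : ℝ} (hy : ‖y‖ ≤ 1) (hR : ‖R‖ ≤ 1) (hne : P + s • R ≠ 0)
    (hx : x = NormedSpace.normalize (P + s • R)) (hu : 0 ≤ ⟪x - y, P⟫_ℝ)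
    (hs : s * (4 + 2 * ⟪x - y, P⟫_ℝ - ⟪y - x, R⟫_ℝ) = ⟪x - y, P⟫_ℝ) (hz : ‖z‖ ≤ 1)
    (hzu : 0 ≤ ⟪z - y, P⟫_ℝ) (hzx : z ≠ x) : gain P R z y < gain P R x y := by
  have hx1 : ‖x‖ ≤ 1 := hx ▸ norm_normalize_le_one _
  rw [gain_eq P R x y z, gain]
  refine mul_add_lt_of_linear_neg (winning_factor_pos hx1 hy hR hu) hu ?_ ?_
  · rw [← inner_add_left]
    simpa using hzu
  · rw [← inner_gainGradient, gainGradient_eq_smul hs, real_inner_smul_right]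
    refine mul_neg_of_pos_of_neg (gradient_factor_pos hx1 hy hR hu) ?_
    rw [inner_sub_left, hx]
    exact sub_neg.2 (inner_lt_inner_normalize hz hne (hx ▸ hzx))

/-! ### Existence of stationary profiles -/

/-- When `R` and `P` point in opposite directions (or one vanishes), each party simply plays its
own most preferred policy. -/
theorem exists_isStationaryProfile_of_eq_neg_smul {r : ℝ} (hr : 0 ≤ r) (hP : ‖P‖ ≤ 1)
    (hR : ‖R‖ ≤ 1) (h : P = -(r • R)) : ∃ x y : E, IsStationaryProfile P R x y := by
  set y := NormedSpace.normalize R with hy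
  set n := ‖R‖ with hn
  have hn0 : 0 ≤ n := norm_nonneg R
  have hrn : r * n ≤ 1 := by
    rw [h, norm_neg, norm_smul, Real.norm_of_nonneg hr] at hP
    exact hP
  have hyR : ⟪y, R⟫_ℝ = n := inner_normalize_self R
  have hu : ⟪-y - y, P⟫_ℝ = 2 * r * n := by
    rw [h, inner_neg_right, real_inner_smul_right, inner_sub_left, inner_neg_left, hyR]
    ring
  have hw : ⟪y - -y, R⟫_ℝ = 2 * n := by
    rw [inner_sub_left, inner_neg_left, hyR]
    ring
  have hgA : gainGradient P R (-y) y = (-(4 * r * (1 + r * n - n))) • R := by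
    rw [gainGradient, hu, hw, h]
    module
  have hgB : gainGradient R P y (-y) = (4 * (1 + n - r * n)) • R := by
    rw [gainGradient, hu, hw, h]
    module
  have hz (z : E) (hz : ‖z‖ ≤ 1) : ⟪z, R⟫_ℝ ≤ n := inner_le_norm_of_norm_le_one hz
  refine ⟨-y, y, by rw [norm_neg]; exact norm_normalize_le_one R, norm_normalize_le_one R,
    by rw [hu]; positivity, by rw [hw]; positivity, fun z hz1 => ?_, fun z hz1 => ?_⟩
  · have := hz (-z) (by rwa [norm_neg])
    rw [inner_neg_left] at this
    rw [hgA, real_inner_smul_right, inner_sub_left, inner_neg_left, hyR]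
    refine mul_nonpos_of_nonpos_of_nonneg (neg_nonpos.2 ?_) (by linarith)
    exact mul_nonneg (by positivity) (by nlinarith [mul_nonneg hr hn0])
  · have := hz z hz1
    rw [hgB, real_inner_smul_right, inner_sub_left, hyR]
    exact mul_nonpos_of_nonneg_of_nonpos (by linarith) (by linarith)

/-- If one policy maximizes `P + s • R` and the other `R + t • P` over the unit ball with
`s, t ∈ [0, 1]`, the first is better for `P` and the second for `R`. -/
theorem normalize_advantage_nonneg {s t : ℝ} (hs : s ∈ Set.Icc (0 : ℝ) 1)
    (ht : t ∈ Set.Icc (0 : ℝ) 1) (hx : x = NormedSpace.normalize (P + s • R))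
    (hy : y = NormedSpace.normalize (R + t • P)) : 0 ≤ ⟪x - y, P⟫_ℝ := by
  have hx1 : ‖x‖ ≤ 1 := hx ▸ norm_normalize_le_one _
  have hy1 : ‖y‖ ≤ 1 := hy ▸ norm_normalize_le_one _
  have h1 : 0 ≤ ⟪x - y, P + s • R⟫_ℝ := by
    rw [inner_sub_left, hx]
    exact sub_nonneg.2 (inner_le_inner_normalize hy1 _)
  have h2 : ⟪x - y, R + t • P⟫_ℝ ≤ 0 := by
    rw [inner_sub_left, hy]
    exact sub_nonpos.2 (inner_le_inner_normalize hx1 _)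
  rw [inner_add_right, real_inner_smul_right] at h1 h2
  have hst : s * t ≤ 1 := mul_le_one₀ hs.2 ht.1 ht.2
  rcases hst.lt_or_eq with hlt | heq
  · have h3 : 0 ≤ (1 - s * t) * ⟪x - y, P⟫_ℝ := by
      nlinarith [mul_nonneg hs.1 (neg_nonneg.2 h2)]
    exact nonneg_of_mul_nonneg_right h3 (by linarith)
  · have hs1 : s = 1 := by nlinarith [hs.1, hs.2, ht.1, ht.2]
    have ht1 : t = 1 := by nlinarith [hs.1, hs.2, ht.1, ht.2]
    have : x = y := by rw [hx, hy, hs1, ht1, one_smul, one_smul, add_comm]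
    simp [this]

/-- When the curves of normalizations of `P + s • R` and `R + t • P` are defined, the first-order
conditions are two scalar equations in `(s, t)`, which have a common root. -/
theorem exists_isStationaryProfile_of_ne_zero (hP : ‖P‖ ≤ 1) (hR : ‖R‖ ≤ 1)
    (hPR : ∀ s : unitInterval, P + (s : ℝ) • R ≠ 0)
    (hRP : ∀ t : unitInterval, R + (t : ℝ) • P ≠ 0) : ∃ x y : E, IsStationaryProfile P R x y := by
  let a : unitInterval → E := fun s => NormedSpace.normalize (P + (s : ℝ) • R)
  let b : unitInterval → E := fun t => NormedSpace.normalize (R + (t : ℝ) • P)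
  have ha : Continuous a := by
    refine Continuous.smul (Continuous.inv₀ (by fun_prop) fun s => ?_) (by fun_prop)
    exact norm_ne_zero_iff.2 (hPR s)
  have hb : Continuous b := by
    refine Continuous.smul (Continuous.inv₀ (by fun_prop) fun t => ?_) (by fun_prop)
    exact norm_ne_zero_iff.2 (hRP t)
  have ha1 (s) : ‖a s‖ ≤ 1 := norm_normalize_le_one _
  have hb1 (t) : ‖b t‖ ≤ 1 := norm_normalize_le_one _
  have hu (s t) : 0 ≤ ⟪a s - b t, P⟫_ℝ := normalize_advantage_nonneg s.2 t.2 rfl rfl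
  have hw (s t) : 0 ≤ ⟪b t - a s, R⟫_ℝ := normalize_advantage_nonneg t.2 s.2 rfl rfl
  have hu2 (s t) : ⟪a s - b t, P⟫_ℝ ≤ 2 := inner_sub_le_two (ha1 s) (hb1 t) hP
  have hw2 (s t) : ⟪b t - a s, R⟫_ℝ ≤ 2 := inner_sub_le_two (hb1 t) (ha1 s) hR
  let F : unitInterval × unitInterval → ℝ := fun p =>
    p.1 * (4 + 2 * ⟪a p.1 - b p.2, P⟫_ℝ - ⟪b p.2 - a p.1, R⟫_ℝ) - ⟪a p.1 - b p.2, P⟫_ℝ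
  let G : unitInterval × unitInterval → ℝ := fun p =>
    p.2 * (4 + 2 * ⟪b p.2 - a p.1, R⟫_ℝ - ⟪a p.1 - b p.2, P⟫_ℝ) - ⟪b p.2 - a p.1, R⟫_ℝ
  obtain ⟨⟨s, t⟩, hs, ht⟩ : ∃ p, F p = 0 ∧ G p = 0 := by
    refine exists_common_zero_of_unique_zero (by fun_prop) (by fun_prop) (fun t => ?_) (fun t => ?_)
      (fun s s' t h h' => ?_) (fun s => ?_) (fun s => ?_)
    · simpa [F] using hu 0 t
    · simp only [F, Set.Icc.coe_one]
      linarith [hu 1 t, hw2 1 t]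
    · -- Two roots would be two best responses to `b t`, each strictly better than the other
      -- unless the policies, and hence the parameters `s` and `s'`, agree.
      have hs := sub_eq_zero.1 h
      have hs' := sub_eq_zero.1 h'
      simp only at hs hs'
      have hab : a s = a s' := by
        by_contra hne
        exact lt_asymm
          (gain_lt_of_normalize (hb1 t) hR (hPR s) rfl (hu s t) hs (ha1 s') (hu s' t) (Ne.symm hne))
          (gain_lt_of_normalize (hb1 t) hR (hPR s') rfl (hu s' t) hs' (ha1 s) (hu s t) hne)
      rw [← hab] at hs'
      exact Subtype.ext (mul_right_cancel₀
        (gradient_factor_pos (ha1 s) (hb1 t) hR (hu s t)).ne' (hs.trans hs'.symm))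
    · simpa [G] using hw s 0
    · simp only [G, Set.Icc.coe_one]
      linarith [hw s 1, hu2 s 1]
  exact ⟨a s, b t, ha1 s, hb1 t, hu s t, hw s t,
    fun z hz => inner_sub_gainGradient_nonpos (hb1 t) hR rfl (hu s t) (sub_eq_zero.1 hs) hz,
    fun z hz => inner_sub_gainGradient_nonpos (ha1 s) hP rfl (hw s t) (sub_eq_zero.1 ht) hz⟩

theorem exists_isStationaryProfile (hP : ‖P‖ ≤ 1) (hR : ‖R‖ ≤ 1) :
    ∃ x y : E, IsStationaryProfile P R x y := by
  by_cases hPR : ∀ s : unitInterval, P + (s : ℝ) • R ≠ 0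
  · by_cases hRP : ∀ t : unitInterval, R + (t : ℝ) • P ≠ 0
    · exact exists_isStationaryProfile_of_ne_zero hP hR hPR hRP
    · push Not at hRP
      obtain ⟨t, ht⟩ := hRP
      obtain ⟨y, x, h⟩ := exists_isStationaryProfile_of_eq_neg_smul t.2.1 hR hP
        (eq_neg_of_add_eq_zero_left ht)
      exact ⟨x, y, h.symm⟩
  · push Not at hPR
    obtain ⟨s, hs⟩ := hPR
    exact exists_isStationaryProfile_of_eq_neg_smul s.2.1 hP hR (eq_neg_of_add_eq_zero_left hs)

end

/-! ### Policy games -/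

/-- The box constraint in the policy domain is implied by the norm constraint. -/
theorem mem_policyDomain_iff {k : ℕ} {z : EuclideanSpace ℝ (Fin k)} :
    z ∈ policyDomain k ↔ ‖z‖ ≤ 1 :=
  ⟨fun h => h.2, fun h => ⟨fun i => abs_le.1 ((PiLp.norm_apply_le z i).trans h), h⟩⟩

namespace PolicyGame

variable {k : ℕ} {V : Type*} [Fintype V] (G : PolicyGame k V)

theorem Q_eq_add : G.Q = ∑ v ∈ G.VA, G.q v + ∑ v ∈ G.VB, G.q v := by
  classical
  rw [Q, ← Finset.sum_union G.disjoint]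
  congr 1
  ext v
  simpa using G.cover v

theorem utilityA_eq_inner (z : EuclideanSpace ℝ (Fin k)) :
    G.utilityA z = ⟪z, ∑ v ∈ G.VA, G.q v⟫_ℝ := (inner_sum _ _ _).symm

theorem utilityB_eq_inner (z : EuclideanSpace ℝ (Fin k)) :
    G.utilityB z = ⟪z, ∑ v ∈ G.VB, G.q v⟫_ℝ := (inner_sum _ _ _).symm

theorem payoffA_eq_gain (x y : EuclideanSpace ℝ (Fin k)) :
    G.payoffA x y =
      1 / 8 * gain (∑ v ∈ G.VA, G.q v) (∑ v ∈ G.VB, G.q v) x y + G.utilityA y := by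
  rw [payoffA, winProbB, winProbA, Q_eq_add, utilityA_eq_inner, utilityA_eq_inner, gain,
    inner_sub_left x y (∑ v ∈ G.VA, G.q v)]
  ring

theorem payoffB_eq_gain (x y : EuclideanSpace ℝ (Fin k)) :
    G.payoffB x y =
      1 / 8 * gain (∑ v ∈ G.VB, G.q v) (∑ v ∈ G.VA, G.q v) y x + G.utilityB x := by
  rw [payoffB, winProbB, winProbA, Q_eq_add, utilityB_eq_inner, utilityB_eq_inner, gain,
    add_comm (∑ v ∈ G.VB, G.q v), ← neg_sub y x, inner_neg_left,
    inner_sub_left y x (∑ v ∈ G.VB, G.q v)]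
  ring

end PolicyGame

theorem theorem3 (k : ℕ) {V : Type*} [Fintype V] (G : PolicyGame k V) :
    ∃ zA zB : EuclideanSpace ℝ (Fin k), G.IsPSNE zA zB ∧ G.Egoistic zA zB := by
  obtain ⟨x, y, h⟩ := exists_isStationaryProfile G.norm_A_le G.norm_B_le
  refine ⟨x, y, ⟨mem_policyDomain_iff.2 h.norm_left, mem_policyDomain_iff.2 h.norm_right,
    fun z hz => ?_, fun z hz => ?_⟩, ?_, ?_⟩
  · have := h.gain_le G.norm_A_le G.norm_B_le (mem_policyDomain_iff.1 hz)
    rw [G.payoffA_eq_gain, G.payoffA_eq_gain]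
    linarith
  · have := h.symm.gain_le G.norm_B_le G.norm_A_le (mem_policyDomain_iff.1 hz)
    rw [G.payoffB_eq_gain, G.payoffB_eq_gain]
    linarith
  · have := h.egoistic_left
    rw [inner_sub_left] at this
    rw [G.utilityA_eq_inner, G.utilityA_eq_inner]
    linarith
  · have := h.egoistic_right
    rw [inner_sub_left] at this
    rw [G.utilityB_eq_inner, G.utilityB_eq_inner]
    linarith
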